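/- Let $\alpha>0$ and $T>0$, and let $g\in L^2_{\mathbb C}((0,T),\tau^\alpha\,d\tau)$, i.e. $g$ is measurable, complex-valued and $\int_0^T|g(\tau)|^2\tau^\alpha\,d\tau<\infty$. For $0<t\le T$ and $x>0$ put $$v(x,t)=\mathcal L_t^\alpha g(x):=\frac{(\alpha/2)^\alpha}{\Gamma(\alpha/2)\,t^\alpha}\int_0^t\frac{x}{(t-\tau)^{\alpha/2+1}}\exp\!\left(-\frac{\alpha^2x^{2/\alpha}}{4(t-\tau)}\right)g(\tau)\,\tau^\alpha\,d\tau .$$ Then this integral converges absolutely for all $0<t\le T$ and $x>0$; for each $t\in(0,T]$ the function $$\xi\longmapsto v(\xi,t)\,\xi^{-\frac{(\alpha-1)(\alpha+2)}{2\alpha}}\,e^{\frac{\alpha^2}{4t}\xi^{2/\alpha}}$$ is infinitely differentiable on $(0,\infty)$; and for every $\xi>0$ and every integer $j\ge 0$, $$\lim_{t\to0^+}t^\alpha\left|\partial_\xi^j\left(v(\xi,t)\,\xi^{-\frac{(\alpha-1)(\alpha+2)}{2\alpha}}\,e^{\frac{\alpha^2}{4t}\xi^{2/\alpha}}\right)\right|^2=0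 .$$ -/

import Mathlib

open MeasureTheory Set Filter Topology
open scoped ContDiff

/-- The measure `τ ^ α dτ` on the interval `(0, T)`. -/
noncomputable def powerMeasure (α T : ℝ) : Measure ℝ :=
  (volume.restrict (Ioo 0 T)).withDensity (fun τ => ENNReal.ofReal (τ ^ α))

/-- The integrand
`x / (t - τ) ^ (α / 2 + 1) * exp (- α ^ 2 x ^ (2 / α) / (4 (t - τ))) * g τ * τ ^ α`
of the transform `𝓛_t^α g (x)`. -/
noncomputable def parabolicIntegrand (α t : ℝ) (g : ℝ → ℂ) (x τ : ℝ) : ℂ :=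
  ((x / (t - τ) ^ (α / 2 + 1) *
      Real.exp (-(α ^ 2 * x ^ (2 / α) / (4 * (t - τ)))) : ℝ) : ℂ) * g τ * ((τ ^ α : ℝ) : ℂ)

/-- The transform `𝓛_t^α g (x)`, for `x > 0`. -/
noncomputable def parabolicTransform (α t : ℝ) (g : ℝ → ℂ) (x : ℝ) : ℂ :=
  (((α / 2) ^ α / (Real.Gamma (α / 2) * t ^ α) : ℝ) : ℂ) *
    ∫ τ in Ioo 0 t, parabolicIntegrand α t g x τ

/-- The function `ξ ↦ v(ξ, t) ξ ^ (-(α - 1)(α + 2) / (2 α)) exp (α ^ 2 ξ ^ (2 / α) / (4 t))`, where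
`v(·, t) = 𝓛_t^α g`. -/
noncomputable def normalizedTransform (α t : ℝ) (g : ℝ → ℂ) (ξ : ℝ) : ℂ :=
  parabolicTransform α t g ξ *
    ((ξ ^ (-((α - 1) * (α + 2) / (2 * α))) *
      Real.exp (α ^ 2 / (4 * t) * ξ ^ (2 / α)) : ℝ) : ℂ)

/-!
Multiplied by `exp (α ^ 2 ξ ^ (2 / α) / (4 t))`, the exponential weight of the transform becomes
`exp (-z s)` with `z = α ^ 2 ξ ^ (2 / α) / 4` and `s = 1 / (t - τ) - 1 / t`. The normalized
transform is therefore, up to elementary factors, a Laplace integral in `s`, and it extends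
holomorphically to a neighbourhood of the positive real axis. The `L²` norm of its kernel against
`τ ^ α dτ` is a Gamma integral in `s`, equal to a constant depending on `Re z` times
`t ^ (α / 2)`; as the prefactor is of order `t ^ (-α)`, the Cauchy–Schwarz inequality bounds
`t ^ (α / 2)` times the extension, locally uniformly, by a multiple of the norm of `g` in
`L²((0, t), τ ^ α dτ)`, which tends to zero with `t`. Cauchy's estimates pass this smallness on to
every derivative.
-/

section HolomorphicFamilies

variable {X E : Type*} [MeasurableSpace X] {μ : Measure X}

theorem norm_integral_smul_le_sqrt_mul_sqrt {𝕜 : Type*} [NormedField 𝕜] [NormedAddCommGroup E]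
    [NormedSpace ℝ E] [NormedSpace 𝕜 E] {f : X → 𝕜} {u : X → E}
    (hf : MemLp f 2 μ) (hu : MemLp u 2 μ) :
    ‖∫ x, f x • u x ∂μ‖ ≤ √(∫ x, ‖f x‖ ^ 2 ∂μ) * √(∫ x, ‖u x‖ ^ 2 ∂μ) := by
  have holder := integral_mul_norm_le_Lp_mul_Lq (f := fun x => ‖f x‖) (g := fun x => ‖u x‖)
    Real.HolderConjugate.two_two (by simpa using hf.norm) (by simpa using hu.norm)
  calc ‖∫ x, f x • u x ∂μ‖ ≤ ∫ x, ‖f x • u x‖ ∂μ := norm_integral_le_integral_norm _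
    _ ≤ √(∫ x, ‖f x‖ ^ 2 ∂μ) * √(∫ x, ‖u x‖ ^ 2 ∂μ) := by
      simpa [norm_smul, Real.sqrt_eq_rpow] using holder

theorem norm_cexp_neg_mul_ofReal (z : ℂ) (s : ℝ) :
    ‖Complex.exp (-(z * s))‖ = Real.exp (-(z.re * s)) := by
  simp [Complex.norm_exp]

theorem mul_exp_neg_mul_le {y s b : ℝ} (hy : 0 < y) (hs : 0 ≤ s) (hb : y / 2 ≤ b) :
    s * Real.exp (-(b * s)) ≤ 4 / y * Real.exp (-(y / 4 * s)) := by
  have hs_le : s ≤ 4 / y * Real.exp (y / 4 * s) :=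
    calc s = 4 / y * (y / 4 * s) := by field_simp
      _ ≤ 4 / y * Real.exp (y / 4 * s) := by
        gcongr
        linarith [Real.add_one_le_exp (y / 4 * s)]
  calc s * Real.exp (-(b * s)) ≤ 4 / y * Real.exp (y / 4 * s) * Real.exp (-(y / 2 * s)) := by
        gcongr
    _ = 4 / y * Real.exp (-(y / 4 * s)) := by
        rw [mul_assoc, ← Real.exp_add]
        ring_nf

theorem differentiableOn_integral_cexp_neg_mul_smul [NormedAddCommGroup E] [NormedSpace ℂ E]
    {s : X → ℝ} {h : X → E} (hs_meas : AEStronglyMeasurable s μ) (hs : 0 ≤ᵐ[μ] s)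
    (hint : ∀ z : ℂ, 0 < z.re → Integrable (fun x => Complex.exp (-(z * s x)) • h x) μ) :
    DifferentiableOn ℂ (fun z => ∫ x, Complex.exp (-(z * s x)) • h x ∂μ) {z | 0 < z.re} := by
  intro z₀ hz₀
  have hz₀ : 0 < z₀.re := hz₀
  have near : {z : ℂ | z₀.re / 2 < z.re} ∈ 𝓝 z₀ :=
    (isOpen_lt continuous_const Complex.continuous_re).mem_nhds (half_lt_self hz₀)
  have integrand_deriv (x : X) (z : ℂ) :
      HasDerivAt (fun z => Complex.exp (-(z * s x)) • h x)
        (-(s x : ℂ) • Complex.exp (-(z * s x)) • h x) z := by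
    have hexp := (((hasDerivAt_id z).mul_const (s x : ℂ)).fun_neg.cexp).smul_const (h x)
    refine hexp.congr_deriv ?_
    simp only [id, smul_smul]
    congr 1
    ring
  have quarter : 0 < ((z₀.re / 4 : ℝ) : ℂ).re := by
    rw [Complex.ofReal_re]
    positivity
  refine (hasDerivAt_integral_of_dominated_loc_of_deriv_le near ?_ (hint z₀ hz₀)
    ((Complex.continuous_ofReal.comp_aestronglyMeasurable hs_meas).neg.smul (hint z₀ hz₀).1)
    ?_ ((hint _ quarter).norm.const_mul (4 / z₀.re))
    (.of_forall fun x z _ => integrand_deriv x z)).2.differentiableAt.differentiableWithinAt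
  · filter_upwards [near] with z hz using (hint z ((half_pos hz₀).trans hz)).1
  · filter_upwards [hs] with x hx z hz
    simp only [norm_smul, norm_neg, Complex.norm_of_nonneg hx, norm_cexp_neg_mul_ofReal,
      Complex.ofReal_re, ← mul_assoc]
    exact mul_le_mul_of_nonneg_right (mul_exp_neg_mul_le hz₀ hx (le_of_lt hz)) (norm_nonneg _)

theorem tendsto_iteratedDeriv_zero_of_norm_le [NormedAddCommGroup E] [NormedSpace ℂ E]
    [CompleteSpace E] {ι : Type*} {l : Filter ι} {U : Set ℂ} {F : ι → ℂ → E} {M : ℂ → ℝ}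
    {ε : ι → ℝ} (hU : IsOpen U) (hF : ∀ᶠ i in l, DifferentiableOn ℂ (F i) U)
    (hM : ContinuousOn M U) (hFM : ∀ᶠ i in l, ∀ z ∈ U, ‖F i z‖ ≤ M z * ε i)
    (hε : Tendsto ε l (𝓝 0)) {z : ℂ} (hz : z ∈ U) (j : ℕ) :
    Tendsto (fun i => iteratedDeriv j (F i) z) l (𝓝 0) := by
  obtain ⟨R, hR, hRU⟩ := Metric.nhds_basis_closedBall.mem_iff.1 (hU.mem_nhds hz)
  obtain ⟨C, hC⟩ := (isCompact_closedBall z R).exists_bound_of_continuousOn (hM.mono hRU)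
  have cauchy : ∀ᶠ i in l, ‖iteratedDeriv j (F i) z‖ ≤ j.factorial * (C * |ε i|) / R ^ j := by
    filter_upwards [hF, hFM] with i hFi hFMi
    refine Complex.norm_iteratedDeriv_le_of_forall_mem_sphere_norm_le j hR
      (hFi.diffContOnCl_ball hRU) fun w hw => ?_
    have hw := Metric.sphere_subset_closedBall hw
    calc ‖F i w‖ ≤ M w * ε i := hFMi w (hRU hw)
      _ ≤ ‖M w‖ * |ε i| := (le_abs_self _).trans (abs_mul _ _).le
      _ ≤ C * |ε i| := by gcongr; exact hC w hw
  refine squeeze_zero_norm' cauchy ?_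
  simpa using ((hε.abs.const_mul C).const_mul (j.factorial : ℝ)).div_const (R ^ j)

variable {f : ℂ → ℂ} {U : Set ℂ}

theorem contDiffOn_comp_ofReal (hU : IsOpen U) (hf : DifferentiableOn ℂ f U)
    (n : WithTop ℕ∞) : ContDiffOn ℝ n (fun x : ℝ => f x) (Complex.ofReal ⁻¹' U) :=
  ((hf.contDiffOn hU).restrict_scalars ℝ).comp Complex.ofRealCLM.contDiff.contDiffOn
    fun _ hx => hx

theorem iteratedDeriv_comp_ofReal (hU : IsOpen U) (hf : DifferentiableOn ℂ f U) (j : ℕ)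
    {x : ℝ} (hx : (x : ℂ) ∈ U) :
    iteratedDeriv j (fun y : ℝ => f y) x = iteratedDeriv j f x := by
  induction j generalizing f with
  | zero => simp only [iteratedDeriv_zero]
  | succ j ih =>
    have deriv_eq : deriv (fun y : ℝ => f y) =ᶠ[𝓝 x] fun y : ℝ => deriv f y := by
      filter_upwards [(hU.preimage Complex.continuous_ofReal).mem_nhds hx] with y hy
        using (hf.differentiableAt (hU.mem_nhds hy)).hasDerivAt.comp_ofReal.deriv
    rw [iteratedDeriv_succ', iteratedDeriv_succ', deriv_eq.iteratedDeriv_eq, ih (hf.deriv hU)]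

end HolomorphicFamilies

section PowerMeasure

variable {α t T : ℝ} {E : Type*} [NormedAddCommGroup E]

theorem ae_mem_Ioo_powerMeasure (α t : ℝ) : ∀ᵐ τ ∂powerMeasure α t, τ ∈ Ioo 0 t :=
  (withDensity_absolutelyContinuous _ _).ae_le (ae_restrict_mem measurableSet_Ioo)

theorem restrict_powerMeasure (α : ℝ) (htT : t ≤ T) :
    (powerMeasure α T).restrict (Ioo 0 t) = powerMeasure α t := by
  rw [powerMeasure, restrict_withDensity measurableSet_Ioo,
    Measure.restrict_restrict_of_subset (Ioo_subset_Ioo_right htT), powerMeasure]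

theorem memLp_powerMeasure_of_le {p : ENNReal} {f : ℝ → E} (htT : t ≤ T)
    (hf : MemLp f p (powerMeasure α T)) : MemLp f p (powerMeasure α t) :=
  restrict_powerMeasure α htT ▸ hf.restrict (Ioo 0 t)

variable [NormedSpace ℝ E]

theorem toReal_ofReal_rpow_smul_ae_eq (α t : ℝ) (f : ℝ → E) :
    (fun τ => (ENNReal.ofReal (τ ^ α)).toReal • f τ) =ᵐ[volume.restrict (Ioo 0 t)]
      fun τ => τ ^ α • f τ := by
  filter_upwards [ae_restrict_mem measurableSet_Ioo] with τ hτ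
  rw [ENNReal.toReal_ofReal (Real.rpow_nonneg hτ.1.le α)]

theorem integral_powerMeasure (α t : ℝ) (f : ℝ → E) :
    ∫ τ, f τ ∂powerMeasure α t = ∫ τ in Ioo 0 t, τ ^ α • f τ := by
  rw [powerMeasure, integral_withDensity_eq_integral_toReal_smul (by fun_prop) (by simp)]
  exact integral_congr_ae (toReal_ofReal_rpow_smul_ae_eq α t f)

theorem integrable_powerMeasure_iff {f : ℝ → E} :
    Integrable f (powerMeasure α t) ↔ IntegrableOn (fun τ => τ ^ α • f τ) (Ioo 0 t) := by
  rw [powerMeasure, integrable_withDensity_iff_integrable_smul' (by fun_prop) (by simp)]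
  exact integrable_congr (toReal_ofReal_rpow_smul_ae_eq α t f)

theorem tendsto_integral_powerMeasure_nhdsGT_zero (hT : 0 < T) {f : ℝ → E}
    (hf : Integrable f (powerMeasure α T)) :
    Tendsto (fun t => ∫ τ, f τ ∂powerMeasure α t) (𝓝[>] 0) (𝓝 0) := by
  have volume_tendsto :
      Tendsto (fun t : ℝ => volume.restrict (Ioo 0 T) (Ioo 0 t)) (𝓝[>] 0) (𝓝 0) := by
    have ofReal_tendsto : Tendsto ENNReal.ofReal (𝓝[>] 0) (𝓝 0) := by
      simpa using (ENNReal.continuous_ofReal.tendsto 0).mono_left nhdsWithin_le_nhds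
    refine tendsto_of_tendsto_of_tendsto_of_le_of_le tendsto_const_nhds ofReal_tendsto
      (fun _ => zero_le) fun t => ?_
    simpa using Measure.restrict_apply_le (μ := volume) (Ioo 0 T) (Ioo 0 t)
  refine ((integrable_powerMeasure_iff.1 hf).tendsto_setIntegral_nhds_zero
    volume_tendsto).congr' ?_
  filter_upwards [Ioc_mem_nhdsGT hT] with t ht
  rw [Measure.restrict_restrict_of_subset (Ioo_subset_Ioo_right ht.2), integral_powerMeasure]

end PowerMeasure

/-- The variable `s = 1 / (t - τ) - 1 / t` in which the transform is a Laplace integral; it maps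
`(0, t)` onto `(0, ∞)`. -/
noncomputable def reciprocalGap (t τ : ℝ) : ℝ :=
  (t - τ)⁻¹ - t⁻¹

section ReciprocalGap

variable {t τ : ℝ}

theorem reciprocalGap_eq_div (hτ : τ ∈ Ioo 0 t) : reciprocalGap t τ = τ / (t * (t - τ)) := by
  have : t ≠ 0 := (hτ.1.trans hτ.2).ne'
  have : t - τ ≠ 0 := (sub_pos.2 hτ.2).ne'
  rw [reciprocalGap]
  field_simp
  ring

theorem reciprocalGap_pos (hτ : τ ∈ Ioo 0 t) : 0 < reciprocalGap t τ := by
  rw [reciprocalGap_eq_div hτ]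
  exact div_pos hτ.1 (mul_pos (hτ.1.trans hτ.2) (sub_pos.2 hτ.2))

theorem measurable_reciprocalGap (t : ℝ) : Measurable (reciprocalGap t) := by
  unfold reciprocalGap
  fun_prop

theorem injective_reciprocalGap (t : ℝ) : Function.Injective (reciprocalGap t) :=
  fun a b hab => by simpa [reciprocalGap] using hab

theorem hasDerivAt_reciprocalGap (hτ : τ ≠ t) :
    HasDerivAt (reciprocalGap t) ((t - τ) ^ 2)⁻¹ τ := by
  have := (((hasDerivAt_id τ).const_sub t).inv (sub_ne_zero.2 hτ.symm)).sub_const t⁻¹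
  refine this.congr_deriv ?_
  simp

theorem image_reciprocalGap_Ioo (ht : 0 < t) : reciprocalGap t '' Ioo 0 t = Ioi 0 := by
  refine Subset.antisymm (image_subset_iff.2 fun τ hτ => reciprocalGap_pos hτ) fun s hs => ?_
  have hs : 0 < s := hs
  refine ⟨t - (s + t⁻¹)⁻¹, ⟨sub_pos.2 ?_, sub_lt_self t (by positivity)⟩, ?_⟩
  · exact inv_lt_of_inv_lt₀ ht (lt_add_of_pos_left _ hs)
  · simp [reciprocalGap]

variable {E : Type*} [NormedAddCommGroup E] [NormedSpace ℝ E]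

theorem integral_comp_reciprocalGap (ht : 0 < t) (f : ℝ → E) :
    ∫ τ in Ioo 0 t, ((t - τ) ^ 2)⁻¹ • f (reciprocalGap t τ) = ∫ s in Ioi 0, f s := by
  rw [← image_reciprocalGap_Ioo ht, integral_image_eq_integral_abs_deriv_smul measurableSet_Ioo
    (fun τ hτ => (hasDerivAt_reciprocalGap hτ.2.ne).hasDerivWithinAt)
    (injective_reciprocalGap t).injOn]
  simp only [abs_inv, abs_sq]

theorem integrableOn_comp_reciprocalGap_iff (ht : 0 < t) {f : ℝ → E} :
    IntegrableOn (fun τ => ((t - τ) ^ 2)⁻¹ • f (reciprocalGap t τ)) (Ioo 0 t) ↔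
      IntegrableOn f (Ioi 0) := by
  rw [← image_reciprocalGap_Ioo ht,
    integrableOn_image_iff_integrableOn_abs_deriv_smul measurableSet_Ioo
      (fun τ hτ => (hasDerivAt_reciprocalGap hτ.2.ne).hasDerivWithinAt)
      (injective_reciprocalGap t).injOn]
  simp only [abs_inv, abs_sq]

end ReciprocalGap

/-- The kernel, with respect to `powerMeasure α t`, of the Laplace integral `parabolicLaplace`. The
spectral parameter `z` stands for `α ^ 2 ξ ^ (2 / α) / 4`; it is complex so that `ξ` can leave the
real axis. -/
noncomputable def parabolicKernel (α t : ℝ) (z : ℂ) (τ : ℝ) : ℂ :=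
  Complex.exp (-(z * reciprocalGap t τ)) * ((t - τ) ^ (-(α / 2 + 1)) : ℝ)

/-- The Laplace integral to which `𝓛_t^α g` reduces once the factors depending only on `t` and `x`
are taken out of the integral. -/
noncomputable def parabolicLaplace (α t : ℝ) (g : ℝ → ℂ) (z : ℂ) : ℂ :=
  ∫ τ, parabolicKernel α t z τ * g τ ∂powerMeasure α t

section ParabolicLaplace

variable {α t : ℝ} {g : ℝ → ℂ} {z : ℂ}

theorem measurable_parabolicKernel (α t : ℝ) (z : ℂ) : Measurable (parabolicKernel α t z) := by
  have := measurable_reciprocalGap t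
  unfold parabolicKernel
  fun_prop

theorem rpow_mul_sq_norm_parabolicKernel (α : ℝ) (z : ℂ) {τ : ℝ} (hτ : τ ∈ Ioo 0 t) :
    τ ^ α * ‖parabolicKernel α t z τ‖ ^ 2 = ((t - τ) ^ 2)⁻¹ *
      (t ^ α * (reciprocalGap t τ ^ α * Real.exp (-(2 * z.re * reciprocalGap t τ)))) := by
  have hgap : 0 < t - τ := sub_pos.2 hτ.2
  have ht : 0 < t := hτ.1.trans hτ.2
  have sq_rpow : ((t - τ) ^ (-(α / 2 + 1))) ^ 2 = ((t - τ) ^ 2)⁻¹ * ((t - τ) ^ α)⁻¹ := by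
    rw [← Real.rpow_mul_natCast hgap.le, ← Real.rpow_natCast (t - τ) 2, ← Real.rpow_neg hgap.le,
      ← Real.rpow_neg hgap.le, ← Real.rpow_add hgap]
    congr 1
    push_cast
    ring
  have sq_exp : Real.exp (-(z.re * reciprocalGap t τ)) ^ 2 =
      Real.exp (-(2 * z.re * reciprocalGap t τ)) := by
    rw [← Real.exp_nat_mul]
    congr 1
    push_cast
    ring
  have gap_rpow : t ^ α * reciprocalGap t τ ^ α = τ ^ α * ((t - τ) ^ α)⁻¹ := by
    rw [reciprocalGap_eq_div hτ, Real.div_rpow hτ.1.le (by positivity),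
      Real.mul_rpow ht.le hgap.le]
    field_simp
  rw [parabolicKernel, norm_mul, norm_cexp_neg_mul_ofReal,
    Complex.norm_of_nonneg (by positivity), mul_pow, sq_rpow, sq_exp, ← mul_assoc (t ^ α), gap_rpow]
  ring

theorem memLp_parabolicKernel (hα : -1 < α) (ht : 0 < t) (hz : 0 < z.re) :
    MemLp (parabolicKernel α t z) 2 (powerMeasure α t) := by
  have integrable_Ioi : IntegrableOn (fun s => s ^ α * Real.exp (-(2 * z.re * s))) (Ioi 0) := by
    simpa using integrableOn_rpow_mul_exp_neg_mul_rpow hα one_pos (mul_pos two_pos hz)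
  rw [memLp_two_iff_integrable_sq_norm (measurable_parabolicKernel α t z).aestronglyMeasurable,
    integrable_powerMeasure_iff]
  refine ((integrableOn_comp_reciprocalGap_iff ht).2 (integrable_Ioi.const_mul (t ^ α))).congr_fun
    (fun τ hτ => (rpow_mul_sq_norm_parabolicKernel α z hτ).symm) measurableSet_Ioo

theorem integral_sq_norm_parabolicKernel (hα : -1 < α) (ht : 0 < t) (hz : 0 < z.re) :
    ∫ τ, ‖parabolicKernel α t z τ‖ ^ 2 ∂powerMeasure α t =
      t ^ α * ((1 / (2 * z.re)) ^ (α + 1) * Real.Gamma (α + 1)) := by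
  have gamma_integral := Real.integral_rpow_mul_exp_neg_mul_Ioi (neg_lt_iff_pos_add.1 hα)
    (mul_pos two_pos hz)
  rw [add_sub_cancel_right] at gamma_integral
  calc ∫ τ, ‖parabolicKernel α t z τ‖ ^ 2 ∂powerMeasure α t
      = ∫ τ in Ioo 0 t, ((t - τ) ^ 2)⁻¹ •
          (t ^ α * (reciprocalGap t τ ^ α * Real.exp (-(2 * z.re * reciprocalGap t τ)))) := by
        rw [integral_powerMeasure]
        exact setIntegral_congr_fun measurableSet_Ioo
          fun τ hτ => rpow_mul_sq_norm_parabolicKernel α z hτ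
    _ = ∫ s in Ioi 0, t ^ α * (s ^ α * Real.exp (-(2 * z.re * s))) :=
        integral_comp_reciprocalGap ht fun s => t ^ α * (s ^ α * Real.exp (-(2 * z.re * s)))
    _ = t ^ α * ((1 / (2 * z.re)) ^ (α + 1) * Real.Gamma (α + 1)) := by
        rw [integral_const_mul, gamma_integral]

theorem integrable_parabolicKernel_mul (hα : -1 < α) (ht : 0 < t) (hz : 0 < z.re)
    (hg : MemLp g 2 (powerMeasure α t)) :
    Integrable (fun τ => parabolicKernel α t z τ * g τ) (powerMeasure α t) :=
  (memLp_parabolicKernel hα ht hz).integrable_mul hg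

theorem differentiableOn_parabolicLaplace (hα : -1 < α) (ht : 0 < t)
    (hg : MemLp g 2 (powerMeasure α t)) :
    DifferentiableOn ℂ (parabolicLaplace α t g) {z | 0 < z.re} := by
  have gap_nonneg : 0 ≤ᵐ[powerMeasure α t] reciprocalGap t := by
    filter_upwards [ae_mem_Ioo_powerMeasure α t] with τ hτ using (reciprocalGap_pos hτ).le
  unfold parabolicLaplace parabolicKernel
  simp only [mul_assoc]
  refine differentiableOn_integral_cexp_neg_mul_smul
    (measurable_reciprocalGap t).aestronglyMeasurable gap_nonneg fun z hz => ?_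
  simpa only [parabolicKernel, mul_assoc, smul_eq_mul] using
    integrable_parabolicKernel_mul hα ht hz hg

theorem norm_parabolicLaplace_le (hα : -1 < α) (ht : 0 < t) (hz : 0 < z.re)
    (hg : MemLp g 2 (powerMeasure α t)) :
    ‖parabolicLaplace α t g z‖ ≤
      √(t ^ α) * √((1 / (2 * z.re)) ^ (α + 1) * Real.Gamma (α + 1)) *
        √(∫ τ, ‖g τ‖ ^ 2 ∂powerMeasure α t) := by
  rw [← Real.sqrt_mul (by positivity), ← integral_sq_norm_parabolicKernel hα ht hz]
  exact norm_integral_smul_le_sqrt_mul_sqrt (memLp_parabolicKernel hα ht hz) hg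

end ParabolicLaplace

/-- The domain of the holomorphic extension of `normalizedTransform α t g`: the `w` for which
`w ^ (2 / α)` lies in the half-plane of convergence of `parabolicLaplace`. -/
def extensionDomain (α : ℝ) : Set ℂ :=
  {w ∈ Complex.slitPlane | 0 < ((α ^ 2 / 4 : ℝ) * w ^ ((2 / α : ℝ) : ℂ)).re}

/-- The holomorphic extension of `normalizedTransform α t g` from `(0, ∞)` to
`extensionDomain α`. -/
noncomputable def holomorphicTransform (α t : ℝ) (g : ℝ → ℂ) (w : ℂ) : ℂ :=
  ((α / 2) ^ α / (Real.Gamma (α / 2) * t ^ α) : ℝ) *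
    (w * w ^ ((-((α - 1) * (α + 2) / (2 * α)) : ℝ) : ℂ)) *
      parabolicLaplace α t g ((α ^ 2 / 4 : ℝ) * w ^ ((2 / α : ℝ) : ℂ))

section HolomorphicTransform

variable {α t T : ℝ} {g : ℝ → ℂ}

theorem differentiableOn_cpow_const_slitPlane (p : ℂ) :
    DifferentiableOn ℂ (fun w => w ^ p) Complex.slitPlane :=
  fun _ hw => (differentiableAt_id.cpow_const hw).differentiableWithinAt

theorem isOpen_extensionDomain (α : ℝ) : IsOpen (extensionDomain α) :=
  (Complex.continuous_re.comp_continuousOn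
    ((differentiableOn_cpow_const_slitPlane _).continuousOn.const_smul
      ((α ^ 2 / 4 : ℝ) : ℂ))).isOpen_inter_preimage Complex.isOpen_slitPlane isOpen_Ioi

theorem ofReal_mem_extensionDomain (hα : α ≠ 0) {x : ℝ} (hx : 0 < x) :
    (x : ℂ) ∈ extensionDomain α := by
  refine ⟨Complex.ofReal_mem_slitPlane.2 hx, ?_⟩
  rw [← Complex.ofReal_cpow hx.le, ← Complex.ofReal_mul, Complex.ofReal_re]
  positivity

theorem differentiableOn_holomorphicTransform (hα : 0 < α) (ht : 0 < t)
    (hg : MemLp g 2 (powerMeasure α t)) :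
    DifferentiableOn ℂ (holomorphicTransform α t g) (extensionDomain α) := by
  have hcpow (p : ℂ) : DifferentiableOn ℂ (fun w => w ^ p) (extensionDomain α) :=
    (differentiableOn_cpow_const_slitPlane p).mono fun _ hw => hw.1
  exact ((differentiableOn_id.mul (hcpow _)).const_mul _).mul
    ((differentiableOn_parabolicLaplace (neg_one_lt_zero.trans hα) ht hg).comp
      ((hcpow _).const_mul _) fun _ hw => hw.2)

/-- The factor depending on `w` in the Cauchy–Schwarz bound for `holomorphicTransform α t g w`. -/
noncomputable def transformBound (α : ℝ) (w : ℂ) : ℝ :=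
  (α / 2) ^ α / Real.Gamma (α / 2) * ‖w * w ^ ((-((α - 1) * (α + 2) / (2 * α)) : ℝ) : ℂ)‖ *
    √((1 / (2 * ((α ^ 2 / 4 : ℝ) * w ^ ((2 / α : ℝ) : ℂ)).re)) ^ (α + 1) * Real.Gamma (α + 1))

theorem continuousOn_transformBound (α : ℝ) :
    ContinuousOn (transformBound α) (extensionDomain α) := by
  have hcpow (p : ℂ) : ContinuousOn (fun w : ℂ => w ^ p) (extensionDomain α) :=
    (differentiableOn_cpow_const_slitPlane p).continuousOn.mono fun _ hw => hw.1
  have hre : ContinuousOn (fun w : ℂ => ((α ^ 2 / 4 : ℝ) * w ^ ((2 / α : ℝ) : ℂ)).re)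
      (extensionDomain α) :=
    Complex.continuous_re.comp_continuousOn (continuousOn_const.mul (hcpow _))
  refine (continuousOn_const.mul (continuousOn_id.mul (hcpow _)).norm).mul
    (ContinuousOn.sqrt (.mul (.rpow_const (continuousOn_const.div (continuousOn_const.mul hre)
      fun w hw => ?_) fun w hw => .inl ?_) continuousOn_const))
  · exact (mul_pos two_pos hw.2).ne'
  · exact (one_div_pos.2 (mul_pos two_pos hw.2)).ne'

theorem norm_sqrt_smul_holomorphicTransform_le (hα : 0 < α) (ht : 0 < t)
    (hg : MemLp g 2 (powerMeasure α t)) {w : ℂ} (hw : w ∈ extensionDomain α) :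
    ‖√(t ^ α) • holomorphicTransform α t g w‖ ≤
      transformBound α w * √(∫ τ, ‖g τ‖ ^ 2 ∂powerMeasure α t) := by
  have laplace_le := norm_parabolicLaplace_le (neg_one_lt_zero.trans hα) ht hw.2 hg
  have cancel_rpow : √(t ^ α) * ((α / 2) ^ α / (Real.Gamma (α / 2) * t ^ α)) * √(t ^ α) =
      (α / 2) ^ α / Real.Gamma (α / 2) := by
    rw [mul_right_comm, Real.mul_self_sqrt (by positivity)]
    field_simp
  rw [holomorphicTransform, transformBound, norm_smul, norm_mul, norm_mul,
    Real.norm_of_nonneg (Real.sqrt_nonneg _), Complex.norm_of_nonneg (by positivity)]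
  refine (mul_le_mul_of_nonneg_left (mul_le_mul_of_nonneg_left laplace_le (by positivity))
    (Real.sqrt_nonneg _)).trans_eq ?_
  rw [← cancel_rpow]
  ring

theorem tendsto_sqrt_smul_iteratedDeriv_holomorphicTransform (hα : 0 < α) (hT : 0 < T)
    (hg : MemLp g 2 (powerMeasure α T)) {w : ℂ} (hw : w ∈ extensionDomain α) (j : ℕ) :
    Tendsto (fun t => √(t ^ α) • iteratedDeriv j (holomorphicTransform α t g) w)
      (𝓝[>] 0) (𝓝 0) := by
  have energy_tendsto : Tendsto (fun t => √(∫ τ, ‖g τ‖ ^ 2 ∂powerMeasure α t)) (𝓝[>] 0) (𝓝 0) := by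
    simpa using (tendsto_integral_powerMeasure_nhdsGT_zero hT
      ((memLp_two_iff_integrable_sq_norm hg.1).1 hg)).sqrt
  have scaled_differentiable : ∀ᶠ t in 𝓝[>] 0,
      DifferentiableOn ℂ (√(t ^ α) • holomorphicTransform α t g) (extensionDomain α) := by
    filter_upwards [Ioc_mem_nhdsGT hT] with t ht
    have hgt := memLp_powerMeasure_of_le ht.2 hg
    exact (differentiableOn_holomorphicTransform hα ht.1 hgt).const_smul _
  have scaled_le : ∀ᶠ t in 𝓝[>] 0, ∀ w ∈ extensionDomain α,
      ‖(√(t ^ α) • holomorphicTransform α t g) w‖ ≤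
        transformBound α w * √(∫ τ, ‖g τ‖ ^ 2 ∂powerMeasure α t) := by
    filter_upwards [Ioc_mem_nhdsGT hT] with t ht w hw using
      norm_sqrt_smul_holomorphicTransform_le hα ht.1 (memLp_powerMeasure_of_le ht.2 hg) hw
  simpa only [iteratedDeriv_const_smul_field] using
    tendsto_iteratedDeriv_zero_of_norm_le (isOpen_extensionDomain α) scaled_differentiable
      (continuousOn_transformBound α) scaled_le energy_tendsto hw j

end HolomorphicTransform

section RealTransform

variable {α t T : ℝ} {g : ℝ → ℂ} {x : ℝ}

theorem parabolicIntegrand_eq (g : ℝ → ℂ) (hx : 0 < x) {τ : ℝ} (hτ : τ ∈ Ioo 0 t) :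
    parabolicIntegrand α t g x τ = (x * Real.exp (-(α ^ 2 / (4 * t) * x ^ (2 / α)))) •
      τ ^ α • (parabolicKernel α t ((α ^ 2 / 4 : ℝ) * (x : ℂ) ^ ((2 / α : ℝ) : ℂ)) τ * g τ) := by
  have hgap : 0 < t - τ := sub_pos.2 hτ.2
  have exp_split : Real.exp (-(α ^ 2 * x ^ (2 / α) / (4 * (t - τ)))) =
      Real.exp (-(α ^ 2 / (4 * t) * x ^ (2 / α))) *
        Real.exp (-(α ^ 2 / 4 * x ^ (2 / α) * reciprocalGap t τ)) := by
    rw [← Real.exp_add]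
    congr 1
    rw [reciprocalGap]
    field_simp
    ring
  rw [parabolicIntegrand, parabolicKernel, exp_split, ← Complex.ofReal_cpow hx.le,
    Real.rpow_neg hgap.le, Complex.real_smul, Complex.real_smul]
  push_cast
  ring

theorem integrableOn_parabolicIntegrand (hα : 0 < α) (ht : 0 < t)
    (hg : MemLp g 2 (powerMeasure α t)) (hx : 0 < x) :
    IntegrableOn (parabolicIntegrand α t g x) (Ioo 0 t) :=
  have integrable_kernel := integrable_powerMeasure_iff.1 (integrable_parabolicKernel_mul
    (neg_one_lt_zero.trans hα) ht (ofReal_mem_extensionDomain hα.ne' hx).2 hg)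
  IntegrableOn.congr_fun (integrable_kernel.smul (x * Real.exp (-(α ^ 2 / (4 * t) * x ^ (2 / α)))))
    (fun _ hτ => (parabolicIntegrand_eq g hx hτ).symm) measurableSet_Ioo

theorem normalizedTransform_eq_holomorphicTransform (α t : ℝ) (g : ℝ → ℂ) (hx : 0 < x) :
    normalizedTransform α t g x = holomorphicTransform α t g x := by
  have integral_eq : ∫ τ in Ioo 0 t, parabolicIntegrand α t g x τ =
      (x * Real.exp (-(α ^ 2 / (4 * t) * x ^ (2 / α)))) •
        parabolicLaplace α t g ((α ^ 2 / 4 : ℝ) * (x : ℂ) ^ ((2 / α : ℝ) : ℂ)) := by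
    rw [setIntegral_congr_fun measurableSet_Ioo fun τ hτ => parabolicIntegrand_eq g hx hτ,
      integral_smul, parabolicLaplace, integral_powerMeasure]
  have exp_cancel : (Real.exp (-(α ^ 2 / (4 * t) * x ^ (2 / α))) : ℂ) *
      Real.exp (α ^ 2 / (4 * t) * x ^ (2 / α)) = 1 := by
    rw [← Complex.ofReal_mul, ← Real.exp_add, neg_add_cancel, Real.exp_zero, Complex.ofReal_one]
  rw [normalizedTransform, parabolicTransform, integral_eq, holomorphicTransform,
    Complex.real_smul, ← Complex.ofReal_cpow hx.le (-((α - 1) * (α + 2) / (2 * α)))]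
  generalize parabolicLaplace α t g _ = L
  rw [Complex.ofReal_mul x, Complex.ofReal_mul (x ^ _)]
  linear_combination (((α / 2) ^ α / (Real.Gamma (α / 2) * t ^ α) : ℝ) : ℂ) * x *
    ((x ^ (-((α - 1) * (α + 2) / (2 * α))) : ℝ) : ℂ) * L * exp_cancel

theorem contDiffOn_normalizedTransform (hα : 0 < α) (ht : 0 < t)
    (hg : MemLp g 2 (powerMeasure α t)) (n : WithTop ℕ∞) :
    ContDiffOn ℝ n (normalizedTransform α t g) (Ioi 0) :=
  ((contDiffOn_comp_ofReal (isOpen_extensionDomain α)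
    (differentiableOn_holomorphicTransform hα ht hg) n).mono
      fun _ hx => ofReal_mem_extensionDomain hα.ne' hx).congr
        fun _ hx => normalizedTransform_eq_holomorphicTransform α t g hx

theorem iteratedDeriv_normalizedTransform (hα : 0 < α) (ht : 0 < t)
    (hg : MemLp g 2 (powerMeasure α t)) (hx : 0 < x) (j : ℕ) :
    iteratedDeriv j (normalizedTransform α t g) x =
      iteratedDeriv j (holomorphicTransform α t g) x := by
  have eventually_eq : normalizedTransform α t g =ᶠ[𝓝 x]
      fun y : ℝ => holomorphicTransform α t g y := by
    filter_upwards [Ioi_mem_nhds hx] with y hy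
      using normalizedTransform_eq_holomorphicTransform α t g hy
  rw [eventually_eq.iteratedDeriv_eq]
  exact iteratedDeriv_comp_ofReal (isOpen_extensionDomain α)
    (differentiableOn_holomorphicTransform hα ht hg) j (ofReal_mem_extensionDomain hα.ne' hx)

end RealTransform

theorem mainTheorem5 (α T : ℝ) (hα : 0 < α) (hT : 0 < T) (g : ℝ → ℂ)
    (hg : MemLp g 2 (powerMeasure α T)) :
    (∀ t ∈ Ioc 0 T, ∀ x : ℝ, 0 < x → IntegrableOn (parabolicIntegrand α t g x) (Ioo 0 t)) ∧
    (∀ t ∈ Ioc 0 T, ContDiffOn ℝ ∞ (normalizedTransform α t g) (Ioi 0)) ∧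
    (∀ ξ : ℝ, 0 < ξ → ∀ j : ℕ,
      Tendsto (fun t : ℝ => t ^ α * ‖iteratedDeriv j (normalizedTransform α t g) ξ‖ ^ 2)
        (𝓝[>] 0) (𝓝 0)) := by
  have hgt {t : ℝ} (ht : t ∈ Ioc 0 T) : MemLp g 2 (powerMeasure α t) :=
    memLp_powerMeasure_of_le ht.2 hg
  refine ⟨fun t ht x hx => integrableOn_parabolicIntegrand hα ht.1 (hgt ht) hx,
    fun t ht => contDiffOn_normalizedTransform hα ht.1 (hgt ht) ∞, fun ξ hξ j => ?_⟩
  have scaled_tendsto := tendsto_sqrt_smul_iteratedDeriv_holomorphicTransform hα hT hg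
    (ofReal_mem_extensionDomain hα.ne' hξ) j
  have sq_tendsto := scaled_tendsto.norm.pow 2
  rw [norm_zero, zero_pow two_ne_zero] at sq_tendsto
  refine sq_tendsto.congr' ?_
  filter_upwards [Ioc_mem_nhdsGT hT] with t ht
  rw [norm_smul, mul_pow, Real.norm_eq_abs, sq_abs, Real.sq_sqrt (Real.rpow_nonneg ht.1.le α),
    iteratedDeriv_normalizedTransform hα ht.1 (hgt ht) hξ]
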